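/- All Hilbert spaces are finite-dimensional and $\log$ is base 2. For linear maps $\mathcal N,\mathcal M$ on operators write $\Vert\mathcal N-\mathcal M\Vert_\diamond=\sup_{k}\sup_{\rho}\Vert(\mathcal I_k\otimes\mathcal N)(\rho)-(\mathcal I_k\otimes\mathcal M)(\rho)\Vert_1$, the supremum being over all reference dimensions $k$ and all states $\rho$ on reference and input, with $\Vert X\Vert_1=\mathrm{tr}|X|$. A non-local quantum computation (NLQC) protocol on $AB$ with resource state $\Psi_{LR}$ consists of quantum channels $\mathcal V_{AL\to K_aM_b}$, $\mathcal V_{RB\to M_aK_b}$, $\mathcal W_{K_aM_a\to A}$, $\mathcal W_{K_bM_b\to B}$, and implements the channel $$\mathcal N_{AB\to AB}(\cdot)=(\mathcal W_{K_aM_a\to A}\otimes\mathcal W_{K_bM_b\to B})\circ(\mathcal V_{AL\to K_aM_b}\otimes\mathcal V_{RB\to M_aK_b})(\,\cdot\otimes\Psi_{LR}).$$ It is an $\epsilon$-correct implementation of a unitary $U_{AB}$ if $\Vert\mathcal N-\mathcal U\Vert_\diamond\le\epsilon$, where $\mathcal U(X)=UXU^\dagger$. Let $S$ be the von Neumann entropy,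 and let $E_f(L:R)_\Psi=\inf\sum_ip_iS(R)_{\psi_i}$ be the entanglement of formation, the infimum being over finite ensembles with $\Psi=\sum_ip_i|\psi_i\rangle\langle\psi_i|$. 1. Let $\{\mathcal N^i\}_i$ be finitely many quantum channels on a $d$-dimensional space, $\{p_i\}$ a probability distribution, $U$ a unitary on that space and $\mathcal U(\cdot)=U(\cdot)U^\dagger$. If $\Vert\sum_ip_i\mathcal N^i-\mathcal U\Vert_\diamond\le\epsilon$, then $\sum_ip_i\Vert\mathcal N^i-\mathcal U\Vert_\diamond\le d\sqrt{2\epsilon}$. 2. Let $U_{AB}$ be a unitary, $\lambda\in\mathbb R$, and let $F:[0,\infty)\to\mathbb R$ be concave and monotone increasing (not necessarily strictly). Suppose that for every $\epsilon$, every $\epsilon$-correct implementation of $U_{AB}$ as an NLQC using a pure resource state $|\Psi\rangle_{LR}$ (with arbitrary finite dimensions of all auxiliary systems) has $S(R)_\Psi\ge\lambda-F(\epsilon)$. Then for every $\epsilon$, every $\epsilon$-correct implementation of $U_{AB}$ as an NLQC using an arbitrary (mixed) resource state $\Psi_{LR}$ has $E_f(L:R)_\Psi\ge\lambda-F(d_{AB}\sqrt{2\epsilon})$,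 where $d_{AB}=d_Ad_B$ is the dimension of $AB$. -/

import Mathlib

open scoped Kronecker BigOperators ComplexOrder

noncomputable section

namespace NLQC

/-- Linear maps from operators on `ℂ^A` to operators on `ℂ^B`. -/
abbrev SuperOp (A B : Type*) : Type _ := Matrix A A ℂ →ₗ[ℂ] Matrix B B ℂ

/-! ### Tensor products of linear maps on operators -/

section Tensor

variable {A B C D : Type*}

/-- The map `I_R ⊗ Φ`: apply `Φ` to every `A`-block of an operator on `ℂ^R ⊗ ℂ^A`. -/
def idTensor (R : Type*) (Φ : SuperOp A B) : SuperOp (R × A) (R × B) where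
  toFun X := Matrix.of fun i j => Φ (X.submatrix (fun a => (i.1, a)) (fun a => (j.1, a))) i.2 j.2
  map_add' X Y := by
    ext i j
    simp [Matrix.submatrix_add]
  map_smul' c X := by
    ext i j
    simp [Matrix.submatrix_smul]

/-- The map `Φ ⊗ I_R`. -/
def tensorId (R : Type*) (Φ : SuperOp A B) : SuperOp (A × R) (B × R) where
  toFun X := Matrix.of fun i j => Φ (X.submatrix (fun a => (a, i.2)) (fun a => (a, j.2))) i.1 j.1
  map_add' X Y := by
    ext i j
    simp [Matrix.submatrix_add]
  map_smul' c X := by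
    ext i j
    simp [Matrix.submatrix_smul]

/-- The map `Φ ⊗ Θ = (Φ ⊗ I) ∘ (I ⊗ Θ)`. -/
def mapTensor (Φ : SuperOp A B) (Θ : SuperOp C D) : SuperOp (A × C) (B × D) :=
  tensorId D Φ ∘ₗ idTensor A Θ

end Tensor

/-! ### States and channels -/

/-- A quantum state (density matrix) on `ℂ^A`. -/
structure QState (A : Type*) [Fintype A] where
  mat : Matrix A A ℂ
  posSemidef : mat.PosSemidef
  trace_eq_one : mat.trace = 1

/-- A unit vector `|ψ⟩` in `ℂ^A`. -/
structure PureState (A : Type*) [Fintype A] where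
  vec : A → ℂ
  norm_sq_eq_one : ∑ a, ‖vec a‖ ^ 2 = 1

/-- The density matrix `|ψ⟩⟨ψ|`. -/
def PureState.toState {A : Type*} [Fintype A] (ψ : PureState A) : QState A where
  mat := Matrix.vecMulVec ψ.vec (star ψ.vec)
  posSemidef := Matrix.posSemidef_vecMulVec_self_star ψ.vec
  trace_eq_one := by
    have h := congrArg (fun x : ℝ => (x : ℂ)) ψ.norm_sq_eq_one
    simp only [Complex.ofReal_sum, Complex.ofReal_pow, Complex.ofReal_one] at h
    rw [← h]
    simp [Matrix.trace, Matrix.vecMulVec_apply, Complex.mul_conj']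

/-- A quantum channel: a completely positive, trace preserving linear map. -/
structure QChannel (A B : Type*) [Fintype A] [Fintype B] where
  map : SuperOp A B
  completely_positive : ∀ (k : ℕ) (X : Matrix (Fin k × A) (Fin k × A) ℂ),
    X.PosSemidef → (idTensor (Fin k) map X).PosSemidef
  trace_preserving : ∀ X : Matrix A A ℂ, (map X).trace = X.trace

/-- The unitary channel `X ↦ U X U†`. -/
def unitaryMap {A : Type*} [Fintype A] [DecidableEq A] (U : Matrix.unitaryGroup A ℂ) :
    SuperOp A A where
  toFun X := (U : Matrix A A ℂ) * X * (U : Matrix A A ℂ).conjTranspose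
  map_add' X Y := by rw [mul_add, add_mul]
  map_smul' c X := by simp

/-! ### Trace norm and diamond distance -/

/-- The trace norm `‖M‖₁ = tr √(M† M)`, the sum of the singular values of `M`. -/
def traceNorm {A : Type*} [Fintype A] [DecidableEq A] (M : Matrix A A ℂ) : ℝ :=
  ∑ i, √((Matrix.isHermitian_conjTranspose_mul_self M).eigenvalues i)

/-- The diamond norm distance (without a factor `1/2`): the supremum of
`‖(I ⊗ Φ)(ρ) - (I ⊗ Θ)(ρ)‖₁` over all finite-dimensional reference systems and all states `ρ` on
reference and input. -/
def diamondDist {A B : Type*} [Fintype A] [Fintype B] [DecidableEq B]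
    (Φ Θ : SuperOp A B) : ℝ :=
  sSup {x : ℝ | ∃ (k : ℕ) (ρ : QState (Fin k × A)),
    x = traceNorm (idTensor (Fin k) Φ ρ.mat - idTensor (Fin k) Θ ρ.mat)}

/-! ### Entropy and entanglement of formation -/

/-- The von Neumann entropy `S(ρ) = - tr (ρ log₂ ρ)`. -/
def entropy {A : Type*} [Fintype A] [DecidableEq A] (ρ : QState A) : ℝ :=
  ∑ i, Real.negMulLog (ρ.posSemidef.isHermitian.eigenvalues i) / Real.log 2

/-- The reduced state on the second factor, `ρ_R = tr_L ρ_{LR}`. -/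
def QState.right {L R : Type*} [Fintype L] [Fintype R] (ρ : QState (L × R)) : QState R where
  mat := ∑ l, ρ.mat.submatrix (fun r => (l, r)) (fun r => (l, r))
  posSemidef := Matrix.posSemidef_sum _ fun l _ => ρ.posSemidef.submatrix _
  trace_eq_one := by
    rw [← ρ.trace_eq_one, Matrix.trace_sum]
    simp [Matrix.trace, Fintype.sum_prod_type]

/-- The entanglement of formation `E_f(L:R)_ρ`: the infimum of `∑ p_i S(R)_{ψ_i}` over all finite
pure-state ensembles with `ρ = ∑ p_i |ψ_i⟩⟨ψ_i|`. -/
def entanglementOfFormation {L R : Type*} [Fintype L] [Fintype R] [DecidableEq R]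
    (ρ : QState (L × R)) : ℝ :=
  sInf {x : ℝ | ∃ (n : ℕ) (p : Fin n → ℝ) (ψ : Fin n → PureState (L × R)),
    (∀ i, 0 ≤ p i) ∧ ∑ i, p i = 1 ∧
    ρ.mat = ∑ i, (p i : ℂ) • (ψ i).toState.mat ∧
    x = ∑ i, p i * entropy (ψ i).toState.right}

/-! ### Non-local quantum computation -/

/-- The operations of a non-local quantum computation with inputs `A` (left), `B` (right), outputs
`A'`, `B'` and a resource system with parts of dimensions `l` (left) and `r` (right).  The systems
`K_a`, `K_b` are kept, `M_b` is sent from left to right and `M_a` from right to left; they have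
arbitrary finite dimensions. -/
structure Protocol (A B A' B' : Type*) [Fintype A] [Fintype B] [Fintype A'] [Fintype B']
    (l r : ℕ) where
  (ka kb ma mb : ℕ)
  /-- first round operation on the left, `AL → K_a M_b` -/
  VL : QChannel (A × Fin l) (Fin ka × Fin mb)
  /-- first round operation on the right, `RB → M_a K_b` -/
  VR : QChannel (Fin r × B) (Fin ma × Fin kb)
  /-- second round operation on the left, `K_a M_a → A'` -/
  WL : QChannel (Fin ka × Fin ma) A'
  /-- second round operation on the right, `K_b M_b → B'` -/
  WR : QChannel (Fin kb × Fin mb) B'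

/-- Attach the resource and group the systems: `X_{AB} ↦ X_{AB} ⊗ Ψ_{LR}`, as an operator on
`(AL)(RB)`. -/
def attach {A B L R : Type*} (Ψ : Matrix (L × R) (L × R) ℂ) :
    SuperOp (A × B) ((A × L) × (R × B)) where
  toFun X := (X ⊗ₖ Ψ).submatrix
    (fun i => ((i.1.1, i.2.2), (i.1.2, i.2.1))) (fun i => ((i.1.1, i.2.2), (i.1.2, i.2.1)))
  map_add' X Y := by
    ext i j
    simp [add_mul]
  map_smul' c X := by
    ext i j
    simp [mul_assoc]

/-- The exchange of messages: regroup `(K_a M_b)(M_a K_b)` as `(K_a M_a)(K_b M_b)`. -/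
def exchange {Ka Kb Ma Mb : Type*} :
    SuperOp ((Ka × Mb) × (Ma × Kb)) ((Ka × Ma) × (Kb × Mb)) where
  toFun X := X.submatrix
    (fun i => ((i.1.1, i.2.2), (i.1.2, i.2.1))) (fun i => ((i.1.1, i.2.2), (i.1.2, i.2.1)))
  map_add' X Y := by rw [Matrix.submatrix_add]; rfl
  map_smul' c X := by rw [Matrix.submatrix_smul]; rfl

/-- The channel `(W_L ⊗ W_R) ∘ (V_L ⊗ V_R) (· ⊗ Ψ_{LR})` implemented by the protocol `P` with
resource state `Ψ`. -/
def Protocol.channel {A B A' B' : Type*} [Fintype A] [Fintype B] [Fintype A'] [Fintype B']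
    {l r : ℕ} (P : Protocol A B A' B' l r) (Ψ : QState (Fin l × Fin r)) :
    SuperOp (A × B) (A' × B') :=
  mapTensor P.WL.map P.WR.map ∘ₗ exchange ∘ₗ mapTensor P.VL.map P.VR.map ∘ₗ attach Ψ.mat

/-- The protocol `P` with resource `Ψ` is an `ε`-correct implementation of the unitary `U`. -/
def Protocol.Implements {A B : Type*} [Fintype A] [Fintype B] [DecidableEq A] [DecidableEq B]
    {l r : ℕ} (P : Protocol A B A B l r) (Ψ : QState (Fin l × Fin r))
    (U : Matrix.unitaryGroup (A × B) ℂ) (ε : ℝ) : Prop :=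
  diamondDist (P.channel Ψ) (unitaryMap U) ≤ ε

end NLQC

end

noncomputable section

namespace NLQC

open Matrix

/-! The first claim rests on comparing the diamond distance to a unitary channel with a quantity
that is affine in the channel: the fidelity of its normalized Choi state with that of the unitary.
The latter is pure, so this fidelity is an expectation value (`entFidelity`) and averages exactly
over a mixture. In one direction, the maximally entangled input is a legitimate test state, and a
traceless Hermitian operator has trace norm at least twice the modulus of any negative expectation
value. This gives `two_mul_one_sub_entFidelity_le`, which is linear in the infidelity. In the other
direction, writing the difference of Choi matrices as `P - Q` with both parts positive bounds the
diamond distance by `tr P + tr Q`. A Fuchs–van de Graaf decomposition makes this at most `2d` times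
the root of the infidelity (`diamondDist_unitaryMap_le`). Concavity of the square root averages
these bounds, and the constant is `d · 2√(ε/2) = d√(2ε)`. For the second claim, a pure-state
ensemble of the resource turns the implemented channel into a mixture of channels with pure
resources. The hypothesis applies to each member with its own error; Jensen for `F`, the first claim
and monotonicity bound the average. This holds for every ensemble, hence for the infimum. -/

theorem trace_re_nonneg {n : Type*} [Fintype n] {S : Matrix n n ℂ} (hS : S.PosSemidef) : 0 ≤ S.trace.re :=
  (Complex.le_def.1 hS.trace_nonneg).1

/-! ### Diagonalization and trace norm estimates -/

section Spectral

variable {n : Type*} [Fintype n] [DecidableEq n]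

/-- Unitary diagonalization, as an explicit product. -/
theorem conjTranspose_eigenvectorUnitary_mul_mul {X : Matrix n n ℂ} (hX : X.IsHermitian) :
    (hX.eigenvectorUnitary : Matrix n n ℂ)ᴴ * X * (hX.eigenvectorUnitary : Matrix n n ℂ)
      = diagonal fun i => (hX.eigenvalues i : ℂ) := by
  have h := hX.conjStarAlgAut_star_eigenvectorUnitary
  rw [Unitary.conjStarAlgAut_star_apply] at h
  exact h

theorem conjTranspose_mul_eigenvectorUnitary {X : Matrix n n ℂ} (hX : X.IsHermitian) :
    (hX.eigenvectorUnitary : Matrix n n ℂ)ᴴ * (hX.eigenvectorUnitary : Matrix n n ℂ) = 1 :=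
  Unitary.coe_star_mul_self hX.eigenvectorUnitary

theorem eigenvectorUnitary_mul_conjTranspose {X : Matrix n n ℂ} (hX : X.IsHermitian) :
    (hX.eigenvectorUnitary : Matrix n n ℂ) * (hX.eigenvectorUnitary : Matrix n n ℂ)ᴴ = 1 :=
  Unitary.coe_mul_star_self hX.eigenvectorUnitary

theorem eq_eigenvectorUnitary_mul_mul {X : Matrix n n ℂ} (hX : X.IsHermitian) :
    X = (hX.eigenvectorUnitary : Matrix n n ℂ) * (diagonal fun i => (hX.eigenvalues i : ℂ))
      * (hX.eigenvectorUnitary : Matrix n n ℂ)ᴴ := by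
  rw [← conjTranspose_eigenvectorUnitary_mul_mul hX]
  calc X = 1 * X * 1 := by simp
    _ = _ := by
      rw [← eigenvectorUnitary_mul_conjTranspose hX]
      simp only [Matrix.mul_assoc]

theorem trace_conj_eigenvectorUnitary {X : Matrix n n ℂ} (hX : X.IsHermitian)
    (M : Matrix n n ℂ) :
    ((hX.eigenvectorUnitary : Matrix n n ℂ)ᴴ * M * (hX.eigenvectorUnitary : Matrix n n ℂ)).trace
      = M.trace := by
  rw [Matrix.trace_mul_cycle, eigenvectorUnitary_mul_conjTranspose hX, one_mul]

/-- The spectral decomposition of a Hermitian matrix into rank-one projections. -/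
theorem eq_sum_eigenvalues_smul_vecMulVec {X : Matrix n n ℂ} (hX : X.IsHermitian) :
    X = ∑ i, (hX.eigenvalues i : ℂ) •
      vecMulVec (fun a => (hX.eigenvectorUnitary : Matrix n n ℂ) a i)
        (star fun a => (hX.eigenvectorUnitary : Matrix n n ℂ) a i) := by
  conv_lhs => rw [eq_eigenvectorUnitary_mul_mul hX]
  ext a b
  rw [Matrix.sum_apply, Matrix.mul_apply]
  refine Finset.sum_congr rfl fun i _ => ?_
  rw [Matrix.mul_diagonal, Matrix.smul_apply, vecMulVec_apply, conjTranspose_apply, smul_eq_mul]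
  simp only [Pi.star_apply]
  ring

theorem star_dotProduct_eigenvectorUnitary {X : Matrix n n ℂ} (hX : X.IsHermitian) (i : n) :
    (star fun a => (hX.eigenvectorUnitary : Matrix n n ℂ) a i) ⬝ᵥ
      (fun a => (hX.eigenvectorUnitary : Matrix n n ℂ) a i) = 1 := by
  have h := congrFun (congrFun (conjTranspose_mul_eigenvectorUnitary hX) i) i
  rw [Matrix.one_apply_eq] at h
  exact h

theorem sum_eigenvalues_eq_trace_re {X : Matrix n n ℂ} (hX : X.IsHermitian) :
    ∑ i, hX.eigenvalues i = X.trace.re := by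
  rw [hX.trace_eq_sum_eigenvalues]
  simp

/-- The eigenvalues of `Xᴴ * X` come without a link to the chosen eigenbasis of `X`, so the two
lists are matched as multisets of roots of one characteristic polynomial. -/
theorem traceNorm_eq_sum_abs_eigenvalues {X : Matrix n n ℂ} (hX : X.IsHermitian) :
    traceNorm X = ∑ i, |hX.eigenvalues i| := by
  have hc : (Xᴴ * X).charpoly
      = ∏ i, (Polynomial.X - Polynomial.C ((hX.eigenvalues i ^ 2 : ℝ) : ℂ)) := by
    set V := (hX.eigenvectorUnitary : Matrix n n ℂ) with hV
    set D := (diagonal fun i => (hX.eigenvalues i : ℂ)) with hD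
    -- Bracketed so that `charpoly_mul_comm` moves `V` to the right, where it cancels against `Vᴴ`.
    have h1 : Xᴴ * X = V * (D * D * Vᴴ) := by
      rw [hX.eq]
      conv_lhs => rw [eq_eigenvectorUnitary_mul_mul hX]
      calc V * D * Vᴴ * (V * D * Vᴴ) = V * D * (Vᴴ * V) * (D * Vᴴ) := by
            simp only [Matrix.mul_assoc]
        _ = _ := by
            rw [conjTranspose_mul_eigenvectorUnitary hX]
            simp only [Matrix.mul_assoc, Matrix.one_mul]
    rw [h1, Matrix.charpoly_mul_comm, Matrix.mul_assoc,
      conjTranspose_mul_eigenvectorUnitary hX, Matrix.mul_one, hD, diagonal_mul_diagonal,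
      charpoly_diagonal]
    refine Finset.prod_congr rfl fun i _ => ?_
    push_cast
    rw [sq]
  have h2 : (Xᴴ * X).charpoly.roots
      = Multiset.map (fun i => ((hX.eigenvalues i ^ 2 : ℝ) : ℂ)) Finset.univ.val := by
    rw [hc, Polynomial.roots_prod]
    · simp only [Polynomial.roots_X_sub_C, Multiset.bind_singleton]
    · exact Finset.prod_ne_zero_iff.2 fun i _ => Polynomial.X_sub_C_ne_zero _
  have h3 := (Matrix.isHermitian_conjTranspose_mul_self X).roots_charpoly_eq_eigenvalues
  rw [h2] at h3
  have h4 := congrArg (fun s : Multiset ℂ => (s.map fun z => √z.re).sum) h3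
  simp only [Multiset.map_map, Function.comp_def, Complex.ofReal_re, Real.sqrt_sq_eq_abs] at h4
  exact h4.symm

/-- The trace norm of a difference of positive operators is at most the sum of their traces. -/
theorem traceNorm_sub_le {P Q : Matrix n n ℂ} (hP : P.PosSemidef) (hQ : Q.PosSemidef) :
    traceNorm (P - Q) ≤ P.trace.re + Q.trace.re := by
  have hX : (P - Q).IsHermitian := hP.isHermitian.sub hQ.isHermitian
  rw [traceNorm_eq_sum_abs_eigenvalues hX]
  set V := (hX.eigenvectorUnitary : Matrix n n ℂ) with hV
  -- In the eigenbasis of `P - Q`, each eigenvalue is a difference of nonnegative diagonal entries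
  -- of `P` and `Q`.
  rw [← trace_conj_eigenvectorUnitary hX P, ← trace_conj_eigenvectorUnitary hX Q, ← hV]
  have hP' := hP.conjTranspose_mul_mul_same V
  have hQ' := hQ.conjTranspose_mul_mul_same V
  simp only [Matrix.trace, Matrix.diag, Complex.re_sum, ← Finset.sum_add_distrib]
  refine Finset.sum_le_sum fun i _ => ?_
  have h := congrFun (congrFun (conjTranspose_eigenvectorUnitary_mul_mul hX) i) i
  rw [← hV, Matrix.mul_sub, Matrix.sub_mul, Matrix.sub_apply, diagonal_apply_eq] at h
  have h' := congrArg Complex.re h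
  rw [Complex.sub_re, Complex.ofReal_re] at h'
  rw [← h']
  have a := (Complex.le_def.1 (hP'.diag_nonneg (i := i))).1
  have b := (Complex.le_def.1 (hQ'.diag_nonneg (i := i))).1
  simp only [Complex.zero_re] at a b
  rw [abs_le]
  constructor <;> linarith

/-- Testing a traceless Hermitian operator against a pure state. -/
theorem neg_two_mul_re_le_traceNorm {X : Matrix n n ℂ} (hX : X.IsHermitian)
    (htr : X.trace = 0) {ψ : n → ℂ} (hψ : star ψ ⬝ᵥ ψ = 1) :
    -2 * (star ψ ⬝ᵥ X *ᵥ ψ).re ≤ traceNorm X := by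
  rw [traceNorm_eq_sum_abs_eigenvalues hX]
  set V := (hX.eigenvectorUnitary : Matrix n n ℂ) with hV
  set φ := Vᴴ *ᵥ ψ with hφ
  have hstar : star φ = star ψ ᵥ* V := by
    rw [hφ, star_mulVec, conjTranspose_conjTranspose]
  have hnorm : ∑ i, Complex.normSq (φ i) = 1 := by
    have h : star φ ⬝ᵥ φ = 1 := by
      rw [hstar, hφ, ← dotProduct_mulVec, mulVec_mulVec, eigenvectorUnitary_mul_conjTranspose hX,
        one_mulVec, hψ]
    have h' := congrArg Complex.re h
    simpa [dotProduct, Complex.normSq_apply] using h'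
  have hval : (star ψ ⬝ᵥ X *ᵥ ψ).re = ∑ i, hX.eigenvalues i * Complex.normSq (φ i) := by
    have h : star ψ ⬝ᵥ X *ᵥ ψ
        = star φ ⬝ᵥ (diagonal fun i => (hX.eigenvalues i : ℂ)) *ᵥ φ := by
      conv_lhs => rw [eq_eigenvectorUnitary_mul_mul hX]
      rw [hstar, hφ, ← dotProduct_mulVec, mulVec_mulVec, mulVec_mulVec]
    rw [h]
    simp only [dotProduct, mulVec_diagonal, Complex.re_sum, Pi.star_apply]
    refine Finset.sum_congr rfl fun i _ => ?_
    simp [Complex.normSq_apply]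
    ring
  have htr' : ∑ i, hX.eigenvalues i = 0 := by
    rw [sum_eigenvalues_eq_trace_re, htr, Complex.zero_re]
  -- The vanishing trace is added as a zero term, which puts the weights `1 - 2|φ i|²` in `[-1, 1]`.
  calc -2 * (star ψ ⬝ᵥ X *ᵥ ψ).re
      = ∑ i, hX.eigenvalues i * (1 - 2 * Complex.normSq (φ i)) := by
        simp only [mul_sub, mul_one, Finset.sum_sub_distrib, htr', hval, Finset.mul_sum]
        rw [zero_sub, ← Finset.sum_neg_distrib]
        exact Finset.sum_congr rfl fun i _ => by ring
    _ ≤ ∑ i, |hX.eigenvalues i| := by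
        refine Finset.sum_le_sum fun i _ => ?_
        have h0 := Complex.normSq_nonneg (φ i)
        have h1 : Complex.normSq (φ i) ≤ 1 := by
          rw [← hnorm]
          exact Finset.single_le_sum (f := fun i => Complex.normSq (φ i))
            (fun j _ => Complex.normSq_nonneg _) (Finset.mem_univ i)
        refine (le_abs_self _).trans ?_
        rw [abs_mul]
        refine mul_le_of_le_one_right (abs_nonneg _) ?_
        rw [abs_le]
        constructor <;> linarith

/-- `tr (S T) ≤ tr S tr T` for positive operators. -/
theorem trace_mul_re_le {S T : Matrix n n ℂ} (hS : S.PosSemidef) (hT : T.PosSemidef) :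
    (S * T).trace.re ≤ S.trace.re * T.trace.re := by
  have hX := hS.isHermitian
  set V := (hX.eigenvectorUnitary : Matrix n n ℂ) with hV
  have hT' := hT.conjTranspose_mul_mul_same V
  have hd : ∀ i, 0 ≤ ((Vᴴ * T * V) i i).re := fun i =>
    (Complex.le_def.1 (hT'.diag_nonneg (i := i))).1
  have h : (S * T).trace
      = ((diagonal fun i => (hX.eigenvalues i : ℂ)) * (Vᴴ * T * V)).trace := by
    conv_lhs => rw [eq_eigenvectorUnitary_mul_mul hX]
    rw [Matrix.mul_assoc, Matrix.mul_assoc, Matrix.trace_mul_comm]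
    simp only [Matrix.mul_assoc]
    rfl
  have hT'tr : T.trace.re = ∑ i, ((Vᴴ * T * V) i i).re := by
    rw [← trace_conj_eigenvectorUnitary hX T, Matrix.trace, Complex.re_sum]
    rfl
  rw [h, ← sum_eigenvalues_eq_trace_re hX, Finset.sum_mul, Matrix.trace, Complex.re_sum]
  refine Finset.sum_le_sum fun i _ => ?_
  rw [Matrix.diag_apply, Matrix.diagonal_mul, Complex.re_ofReal_mul, hT'tr]
  refine mul_le_mul_of_nonneg_left ?_ (hS.eigenvalues_nonneg i)
  exact Finset.single_le_sum (f := fun i => ((Vᴴ * T * V) i i).re)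
            (fun j _ => hd j) (Finset.mem_univ i)

end Spectral

/-! ### Positive decompositions and the Fuchs–van de Graaf bound -/

section FuchsVanDeGraaf

variable {n : Type*} [Fintype n]

/-- Jordan decomposition of the difference of two pure states. -/
theorem exists_posSemidef_sub_eq_pure {a b : n → ℂ} (ha : star a ⬝ᵥ a = 1)
    (hb : star b ⬝ᵥ b = 1) :
    ∃ P Q : Matrix n n ℂ, P.PosSemidef ∧ Q.PosSemidef ∧
      vecMulVec a (star a) - vecMulVec b (star b) = P - Q ∧
      0 ≤ 1 - Complex.normSq (star a ⬝ᵥ b) ∧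
      P.trace.re + Q.trace.re = 2 * √(1 - Complex.normSq (star a ⬝ᵥ b)) := by
  classical
  set X := vecMulVec a (star a) - vecMulVec b (star b) with hX
  set c := star a ⬝ᵥ b with hc
  set t : ℝ := 1 - Complex.normSq c with ht
  have hc' : star b ⬝ᵥ a = star c := by
    rw [hc, ← star_dotProduct_star, star_star, dotProduct_comm]
  have hXh : Xᴴ = X := (posSemidef_vecMulVec_self_star a).isHermitian.sub
    (posSemidef_vecMulVec_self_star b).isHermitian
  have hcc : c * star c = ((1 - t : ℝ) : ℂ) := by
    rw [ht, Complex.star_def, Complex.mul_conj]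
    simp
  have hX2 : X * X = vecMulVec a (star a) - c • vecMulVec a (star b)
      - star c • vecMulVec b (star a) + vecMulVec b (star b) := by
    rw [hX, mul_sub, sub_mul, sub_mul]
    simp only [vecMulVec_mul_vecMulVec, ha, hb, hc', ← hc, vecMulVec_smul, one_smul]
    abel
  -- This forces the eigenvalues of `X` into `{0, √t, -√t}`, so its positive and negative parts are
  -- quadratic polynomials in `X`.
  have hX3 : X * X * X = (t : ℂ) • X := by
    have : (t : ℂ) = 1 - c * star c := by rw [hcc]; push_cast; ring
    rw [hX2, hX, this]
    simp only [mul_sub, sub_mul, add_mul, smul_mul_assoc, vecMulVec_mul_vecMulVec, ha, hb, hc',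
      ← hc, vecMulVec_smul, one_smul]
    module
  have htr : (X * X).trace = ((2 * t : ℝ) : ℂ) := by
    rw [hX2]
    simp only [trace_add, trace_sub, trace_smul, trace_vecMulVec, smul_eq_mul,
      dotProduct_comm _ (star _), ha, hb, hc', ← hc]
    rw [mul_comm (star c), hcc]
    push_cast
    ring
  have hXX : (X * X).PosSemidef := by
    have h := posSemidef_conjTranspose_mul_self X
    rwa [hXh] at h
  have ht0 : 0 ≤ t := by
    have h := trace_re_nonneg hXX
    rw [htr, Complex.ofReal_re] at h
    linarith
  rcases ht0.eq_or_lt with h0 | hpos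
  -- Here `tr X² = 2t = 0`; the division by `√t` below is unavailable.
  · have hX0 : X = 0 := by
      rw [← trace_conjTranspose_mul_self_eq_zero_iff, hXh, htr, ← h0]
      simp
    refine ⟨0, 0, PosSemidef.zero, PosSemidef.zero, by simp [hX0], ht0, ?_⟩
    rw [← h0]
    simp
  · set s := √t with hs
    have hs0 : 0 < s := Real.sqrt_pos.2 hpos
    have hss : (t : ℂ) = (s : ℂ) * s := by
      rw [← Complex.ofReal_mul, hs, Real.mul_self_sqrt ht0]
    have hsC : (s : ℂ) ≠ 0 := by exact_mod_cast hs0.ne'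
    -- Up to the factor `1/(2s)`, the signs `σ = 1, -1` give the positive and negative parts of `X`.
    -- Positivity follows since `Y` is Hermitian with `Y² = 2s² Y`, hence a positive multiple of `Yᴴ
    -- * Y`.
    have key : ∀ σ : ℂ, star σ = σ → σ * σ = 1 → (X * X + (σ * s) • X).PosSemidef := by
      intro σ hσ hσ2
      set Y := X * X + (σ * s) • X with hY
      have hYh : Yᴴ = Y := by
        rw [hY, conjTranspose_add, conjTranspose_mul, conjTranspose_smul, hXh, star_mul', hσ]
        simp
      have hYY : Yᴴ * Y = (2 * ((s : ℂ) * s)) • Y := by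
        have h4 : X * X * (X * X) = ((s : ℂ) * s) • (X * X) := by
          rw [← mul_assoc, hX3, hss, smul_mul_assoc]
        rw [hYh, hY]
        simp only [mul_add, add_mul, smul_mul_assoc, mul_smul_comm, h4, hX3, ← mul_assoc X X X,
          hss, smul_add]
        have e : (σ * s) • (σ * (s : ℂ)) • (X * X) = ((s : ℂ) * s) • (X * X) := by
          rw [smul_smul]
          congr 1
          linear_combination ((s : ℂ) * s) * hσ2
        rw [e]
        module
      have hYe : Y = ((2 * (s * s))⁻¹ : ℝ) • (Yᴴ * Y) := by
        rw [hYY, ← Complex.coe_smul, smul_smul]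
        push_cast
        rw [inv_mul_cancel₀ (by simp [hsC]), one_smul]
      rw [hYe]
      exact (posSemidef_conjTranspose_mul_self Y).smul (by positivity)
    have hk1 := key 1 (by simp) (by simp)
    have hk2 := key (-1) (by simp) (by simp)
    have htrX : (((2 * s)⁻¹ : ℝ) • (X * X + ((1 : ℂ) * s) • X)).trace.re
        + (((2 * s)⁻¹ : ℝ) • (X * X + ((-1 : ℂ) * s) • X)).trace.re = 2 * s := by
      rw [← Complex.add_re, ← trace_add, ← smul_add]
      have : X * X + ((1 : ℂ) * s) • X + (X * X + ((-1 : ℂ) * s) • X) = (2 : ℝ) • (X * X) := by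
        rw [← Complex.coe_smul]
        push_cast
        module
      rw [this, smul_smul, trace_smul, htr, Complex.smul_re, Complex.ofReal_re, smul_eq_mul,
        ← Real.mul_self_sqrt ht0, ← hs]
      field_simp
    refine ⟨_, _, hk1.smul (a := ((2 * s)⁻¹ : ℝ)) (by positivity),
      hk2.smul (a := ((2 * s)⁻¹ : ℝ)) (by positivity), ?_, ht0, htrX⟩
    rw [← smul_sub]
    have : X * X + ((1 : ℂ) * s) • X - (X * X + ((-1 : ℂ) * s) • X) = (2 * s : ℝ) • X := by
      rw [← Complex.coe_smul]
      push_cast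
      module
    rw [this, smul_smul, inv_mul_cancel₀ (by positivity), one_smul]

/-- Jordan-type decomposition of the difference of a mixed state and a pure state, with the
Fuchs–van de Graaf bound on the traces. -/
theorem exists_posSemidef_sub_eq_state {ρ : Matrix n n ℂ} (hρ : ρ.PosSemidef)
    (htr : ρ.trace = 1) {b : n → ℂ} (hb : star b ⬝ᵥ b = 1) :
    ∃ P Q : Matrix n n ℂ, P.PosSemidef ∧ Q.PosSemidef ∧
      ρ - vecMulVec b (star b) = P - Q ∧
      0 ≤ 1 - (star b ⬝ᵥ ρ *ᵥ b).re ∧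
      P.trace.re + Q.trace.re ≤ 2 * √(1 - (star b ⬝ᵥ ρ *ᵥ b).re) := by
  classical
  have hH := hρ.isHermitian
  set q := hH.eigenvalues with hq
  set e : n → n → ℂ := fun i a => (hH.eigenvectorUnitary : Matrix n n ℂ) a i with he
  have hq0 : ∀ i, 0 ≤ q i := hρ.eigenvalues_nonneg
  have hq1 : ∑ i, q i = 1 := by
    rw [hq, sum_eigenvalues_eq_trace_re, htr, Complex.one_re]
  have hdec : ρ = ∑ i, q i • vecMulVec (e i) (star (e i)) := by
    simp only [← Complex.coe_smul]
    exact eq_sum_eigenvalues_smul_vecMulVec hH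
  -- Each eigenvector of `ρ` is compared with `b` separately; such decompositions can be mixed with
  -- the weights `q i`, and concavity of the root then handles the traces.
  choose P Q hP hQ hPQ h0 hT using fun i =>
    exists_posSemidef_sub_eq_pure (star_dotProduct_eigenvectorUnitary hH i) hb
  have hval : 1 - (star b ⬝ᵥ ρ *ᵥ b).re
      = ∑ i, q i * (1 - Complex.normSq (star (e i) ⬝ᵥ b)) := by
    have h : (star b ⬝ᵥ ρ *ᵥ b).re = ∑ i, q i * Complex.normSq (star (e i) ⬝ᵥ b) := by
      rw [hdec, sum_mulVec, dotProduct_sum, Complex.re_sum]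
      refine Finset.sum_congr rfl fun i _ => ?_
      have hc : star b ⬝ᵥ e i = star (star (e i) ⬝ᵥ b) := by
        rw [← star_dotProduct_star, star_star, dotProduct_comm]
      rw [smul_mulVec, dotProduct_smul, Complex.smul_re, vecMulVec_mulVec, smul_eq_mul]
      congr 1
      rw [← Complex.ofReal_re (Complex.normSq _), Complex.normSq_eq_conj_mul_self]
      simp [dotProduct_smul, hc]
    rw [h]
    simp only [mul_sub, mul_one, Finset.sum_sub_distrib, hq1]
  refine ⟨∑ i, q i • P i, ∑ i, q i • Q i, posSemidef_sum _ fun i _ => (hP i).smul (hq0 i),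
    posSemidef_sum _ fun i _ => (hQ i).smul (hq0 i), ?_, ?_, ?_⟩
  · rw [← Finset.sum_sub_distrib]
    simp only [← smul_sub, ← hPQ]
    simp only [smul_sub, Finset.sum_sub_distrib]
    rw [← Finset.sum_smul, hq1, one_smul, ← hdec]
  · rw [hval]
    exact Finset.sum_nonneg fun i _ => mul_nonneg (hq0 i) (h0 i)
  · have hJ := Real.strictConcaveOn_sqrt.concaveOn.le_map_sum (t := Finset.univ) (w := q)
      (p := fun i => 1 - Complex.normSq (star (e i) ⬝ᵥ b)) (fun i _ => hq0 i) hq1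
      (fun i _ => h0 i)
    simp only [smul_eq_mul] at hJ
    rw [hval, trace_sum, trace_sum, Complex.re_sum, Complex.re_sum, ← Finset.sum_add_distrib]
    calc ∑ i, ((q i • P i).trace.re + (q i • Q i).trace.re)
        = ∑ i, 2 * (q i * √(1 - Complex.normSq (star (e i) ⬝ᵥ b))) := by
          refine Finset.sum_congr rfl fun i _ => ?_
          rw [trace_smul, trace_smul, Complex.smul_re, Complex.smul_re, ← smul_add]
          rw [hT i, smul_eq_mul]
          ring
      _ ≤ _ := by
          rw [← Finset.mul_sum]
          exact mul_le_mul_of_nonneg_left hJ (by norm_num)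

end FuchsVanDeGraaf

/-- Summing over the blocks of a positive operator gives a positive operator. -/
theorem posSemidef_sum_sum {I A : Type*} [Fintype I] [Fintype A]
    {M : Matrix (I × A) (I × A) ℂ} (hM : M.PosSemidef) :
    (Matrix.of fun i j => ∑ a, ∑ a', M (i, a) (j, a')).PosSemidef := by
  classical
  set W : Matrix I (I × A) ℂ := Matrix.of fun i z => if z.1 = i then 1 else 0 with hW
  convert hM.mul_mul_conjTranspose_same W using 1
  ext i j
  have h : ∀ z, (W * M) i z = ∑ a, M (i, a) z := fun z => by
    rw [Matrix.mul_apply, Fintype.sum_prod_type, Finset.sum_comm]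
    simp [hW]
  rw [Matrix.mul_apply, Fintype.sum_prod_type, Finset.sum_comm]
  simp only [h]
  simp only [conjTranspose_apply, hW, Matrix.of_apply, apply_ite star, star_one, star_zero,
    mul_ite, mul_one, mul_zero, Finset.sum_ite_eq', Finset.mem_univ, if_true]
  exact Finset.sum_comm


/-! ### Choi matrices and bounds on the diamond distance -/

section Choi

variable {A B : Type*} [Fintype A] [DecidableEq A]

/-- The (unnormalized) Choi matrix of a linear map on operators. -/
def choi (Φ : SuperOp A B) : Matrix (A × B) (A × B) ℂ :=
  Matrix.of fun i j => Φ (Matrix.single i.1 j.1 1) i.2 j.2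

theorem idTensor_apply_eq_sum_choi {R : Type*} (Φ : SuperOp A B)
    (X : Matrix (R × A) (R × A) ℂ) (i j : R × B) :
    idTensor R Φ X i j = ∑ a, ∑ a', X (i.1, a) (j.1, a') * choi Φ (a, i.2) (a', j.2) := by
  change Φ (X.submatrix (fun a => (i.1, a)) (fun a => (j.1, a))) i.2 j.2 = _
  rw [Matrix.matrix_eq_sum_single (X.submatrix (fun a => (i.1, a)) (fun a => (j.1, a)))]
  simp only [map_sum, Matrix.sum_apply]
  refine Finset.sum_congr rfl fun a _ => Finset.sum_congr rfl fun a' _ => ?_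
  have : Matrix.single a a' (X (i.1, a) (j.1, a')) =
      X (i.1, a) (j.1, a') • Matrix.single a a' (1 : ℂ) := by
    rw [Matrix.smul_single, smul_eq_mul, mul_one]
  rw [Matrix.submatrix_apply, this, map_smul]
  rfl

/-- The action on `X` of the linear map with Choi matrix `C`, tensored with an identity map. -/
def contract {R : Type*} (X : Matrix (R × A) (R × A) ℂ) (C : Matrix (A × B) (A × B) ℂ) :
    Matrix (R × B) (R × B) ℂ :=
  Matrix.of fun i j => ∑ a, ∑ a', X (i.1, a) (j.1, a') * C (a, i.2) (a', j.2)

variable [Fintype B]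

-- The contraction is a block sum of a principal submatrix of `X ⊗ₖ C`: the one in which the two
-- copies of the `A` index agree.
omit [DecidableEq A] in
theorem contract_posSemidef {R : Type*} [Fintype R] {X : Matrix (R × A) (R × A) ℂ}
    {C : Matrix (A × B) (A × B) ℂ} (hX : X.PosSemidef) (hC : C.PosSemidef) :
    (contract X C).PosSemidef := by
  classical
  have h := (hX.kronecker hC).submatrix fun z : (R × B) × A => ((z.1.1, z.2), (z.2, z.1.2))
  have h' := posSemidef_sum_sum h
  simp only [Matrix.submatrix_apply, Matrix.kroneckerMap_apply] at h'
  exact h'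

-- Only the marginals on `A` enter: the trace is the pairing of `S` with the transpose of `T`, and
-- `trace_mul_re_le` applies.
omit [DecidableEq A] in
theorem trace_contract_re_le {R : Type*} [Fintype R] {X : Matrix (R × A) (R × A) ℂ}
    {C : Matrix (A × B) (A × B) ℂ} (hX : X.PosSemidef) (hC : C.PosSemidef) :
    (contract X C).trace.re ≤ X.trace.re * C.trace.re := by
  classical
  set S : Matrix A A ℂ := ∑ r, X.submatrix (fun a => (r, a)) (fun a => (r, a)) with hS
  set T : Matrix A A ℂ := ∑ b, C.submatrix (fun a => (a, b)) (fun a => (a, b)) with hT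
  have hSp : S.PosSemidef := posSemidef_sum _ fun r _ => hX.submatrix _
  have hTp : T.PosSemidef := posSemidef_sum _ fun b _ => hC.submatrix _
  have h1 : S.trace = X.trace := by
    rw [hS, trace_sum]
    simp [Matrix.trace, Fintype.sum_prod_type]
  have h2 : T.trace = C.trace := by
    rw [hT, trace_sum]
    simp [Matrix.trace, Fintype.sum_prod_type_right]
  have h3 : (contract X C).trace = (S * Tᵀ).trace := by
    simp only [Matrix.trace, Matrix.diag, contract, Matrix.of_apply, Matrix.mul_apply,
      Matrix.transpose_apply, hS, hT, Matrix.sum_apply, Matrix.submatrix_apply,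
      Fintype.sum_prod_type, Finset.sum_mul_sum]
    calc _ = ∑ r, ∑ a, ∑ b, ∑ a', X (r, a) (r, a') * C (a, b) (a', b) :=
          Finset.sum_congr rfl fun r _ => Finset.sum_comm
      _ = ∑ a, ∑ r, ∑ a', ∑ b, X (r, a) (r, a') * C (a, b) (a', b) := by
          rw [Finset.sum_comm]
          exact Finset.sum_congr rfl fun a _ => Finset.sum_congr rfl fun r _ => Finset.sum_comm
      _ = _ := Finset.sum_congr rfl fun a _ => Finset.sum_comm
  rw [h3, ← h1, ← h2, ← trace_transpose T]
  exact trace_mul_re_le hSp hTp.transpose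

/-- A decomposition of the difference of Choi matrices bounds the distance of the outputs. -/
theorem traceNorm_idTensor_sub_le [DecidableEq B] {Φ Θ : SuperOp A B}
    {P Q : Matrix (A × B) (A × B) ℂ} (hP : P.PosSemidef) (hQ : Q.PosSemidef)
    (h : choi Φ - choi Θ = P - Q) {R : Type*} [Fintype R] [DecidableEq R] (ρ : QState (R × A)) :
    traceNorm (idTensor R Φ ρ.mat - idTensor R Θ ρ.mat) ≤ P.trace.re + Q.trace.re := by
  have he : idTensor R Φ ρ.mat - idTensor R Θ ρ.mat = contract ρ.mat P - contract ρ.mat Q := by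
    ext i j
    rw [Matrix.sub_apply, Matrix.sub_apply, idTensor_apply_eq_sum_choi,
      idTensor_apply_eq_sum_choi]
    simp only [contract, Matrix.of_apply, ← Finset.sum_sub_distrib, ← mul_sub]
    refine Finset.sum_congr rfl fun a _ => Finset.sum_congr rfl fun a' _ => ?_
    rw [← Matrix.sub_apply, h, Matrix.sub_apply]
  have hp := ρ.posSemidef
  have h1 := trace_contract_re_le hp hP
  have h2 := trace_contract_re_le hp hQ
  rw [ρ.trace_eq_one, Complex.one_re, one_mul] at h1 h2
  rw [he]
  exact (traceNorm_sub_le (contract_posSemidef hp hP) (contract_posSemidef hp hQ)).trans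
    (add_le_add h1 h2)

theorem traceNorm_nonneg {n : Type*} [Fintype n] [DecidableEq n] (M : Matrix n n ℂ) :
    0 ≤ traceNorm M :=
  Finset.sum_nonneg fun _ _ => Real.sqrt_nonneg _

omit [DecidableEq A] in
theorem diamondDist_nonneg [DecidableEq B] (Φ Θ : SuperOp A B) : 0 ≤ diamondDist Φ Θ := by
  refine Real.sSup_nonneg ?_
  rintro x ⟨k, ρ, rfl⟩
  exact traceNorm_nonneg _

theorem diamondDist_le_of_choi_sub_eq [DecidableEq B] {Φ Θ : SuperOp A B}
    {P Q : Matrix (A × B) (A × B) ℂ} (hP : P.PosSemidef) (hQ : Q.PosSemidef)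
    (h : choi Φ - choi Θ = P - Q) : diamondDist Φ Θ ≤ P.trace.re + Q.trace.re := by
  refine Real.sSup_le ?_ (add_nonneg (trace_re_nonneg hP) (trace_re_nonneg hQ))
  rintro x ⟨k, ρ, rfl⟩
  exact traceNorm_idTensor_sub_le hP hQ h ρ

/-- The content is boundedness of the set, since the real `sSup` of an unbounded set is `0`. The two
Choi matrices themselves serve as `P` and `Q`. -/
theorem traceNorm_le_diamondDist [DecidableEq B] {Φ Θ : SuperOp A B}
    (hΦ : (choi Φ).PosSemidef) (hΘ : (choi Θ).PosSemidef) {k : ℕ} (ρ : QState (Fin k × A)) :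
    traceNorm (idTensor (Fin k) Φ ρ.mat - idTensor (Fin k) Θ ρ.mat) ≤ diamondDist Φ Θ := by
  refine le_csSup ⟨(choi Φ).trace.re + (choi Θ).trace.re, ?_⟩ ⟨k, ρ, rfl⟩
  rintro x ⟨k, ρ, rfl⟩
  exact traceNorm_idTensor_sub_le hΦ hΘ rfl ρ

end Choi

/-! ### The maximally entangled state and Choi matrices of channels -/

section MaxEntangled

variable {A B : Type*} [Fintype A] [DecidableEq A]

/-- The unnormalized maximally entangled vector, with the reference identified along `e`. -/
def maxEntangled {k : ℕ} (e : A ≃ Fin k) : Fin k × A → ℂ := fun i => if i.1 = e i.2 then 1 else 0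

omit [Fintype A] in
theorem idTensor_maxEntangled {k : ℕ} (e : A ≃ Fin k) (Φ : SuperOp A B) :
    idTensor (Fin k) Φ (vecMulVec (maxEntangled e) (star (maxEntangled e)))
      = (choi Φ).submatrix (e.symm.prodCongr (Equiv.refl B))
          (e.symm.prodCongr (Equiv.refl B)) := by
  ext i j
  refine congrArg (fun M => Φ M i.2 j.2) (a₁ := Matrix.submatrix _ _ _) (Matrix.ext fun a a' => ?_)
  simp only [submatrix_apply, vecMulVec_apply, maxEntangled, Pi.star_apply, Matrix.single_apply,
    Equiv.prodCongr_apply, Prod.map_fst, apply_ite star, star_one, star_zero,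
    Equiv.symm_apply_eq]
  split_ifs <;> simp_all

/-- Up to reindexing, the Choi matrix is the output on the positive rank-one operator of the
maximally entangled vector. -/
theorem choi_posSemidef [Fintype B] (N : QChannel A B) : (choi N.map).PosSemidef := by
  have h := N.completely_positive _ _
    (posSemidef_vecMulVec_self_star (maxEntangled (Fintype.equivFin A)))
  rw [idTensor_maxEntangled, posSemidef_submatrix_equiv] at h
  exact h

theorem trace_choi [Fintype B] {Φ : SuperOp A B} (hΦ : ∀ X, (Φ X).trace = X.trace) :
    (choi Φ).trace = Fintype.card A := by
  have h : (choi Φ).trace = ∑ a, (Φ (Matrix.single a a 1)).trace := by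
    simp [Matrix.trace, choi, Fintype.sum_prod_type]
  rw [h]
  simp [hΦ]

omit [Fintype A] in
theorem choi_sum_smul {ι : Type*} [Fintype ι] (N : ι → SuperOp A B) (p : ι → ℝ) :
    choi (∑ i, (p i : ℂ) • N i) = ∑ i, p i • choi (N i) := by
  ext x y
  simp [choi, Matrix.sum_apply, LinearMap.sum_apply]

/-- The normalized maximally entangled state. -/
def maxEntangledState [Nonempty A] {k : ℕ} (e : A ≃ Fin k) : QState (Fin k × A) where
  mat := (Fintype.card A : ℝ)⁻¹ • vecMulVec (maxEntangled e) (star (maxEntangled e))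
  posSemidef := (posSemidef_vecMulVec_self_star _).smul (by positivity)
  trace_eq_one := by
    have h : (vecMulVec (maxEntangled e) (star (maxEntangled e))).trace = Fintype.card A := by
      simp [trace_vecMulVec, dotProduct, maxEntangled, Fintype.sum_prod_type_right]
    rw [trace_smul, h, ← Complex.coe_smul, smul_eq_mul]
    push_cast
    exact inv_mul_cancel₀ (by simp [Fintype.card_ne_zero])

end MaxEntangled

/-! ### Entanglement fidelity with a unitary channel -/

section Unitary

variable {H : Type*} [Fintype H] [DecidableEq H]

theorem trace_unitaryMap (U : Matrix.unitaryGroup H ℂ) (X : Matrix H H ℂ) :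
    (unitaryMap U X).trace = X.trace := by
  change ((U : Matrix H H ℂ) * X * (U : Matrix H H ℂ)ᴴ).trace = _
  have h : (U : Matrix H H ℂ)ᴴ * (U : Matrix H H ℂ) = 1 := Unitary.coe_star_mul_self U
  rw [Matrix.trace_mul_cycle, h, one_mul]

/-- The vector of the normalized Choi state of a unitary. -/
def choiVec (U : Matrix.unitaryGroup H ℂ) : H × H → ℂ :=
  fun x => (√(Fintype.card H : ℝ) : ℂ)⁻¹ * (U : Matrix H H ℂ) x.2 x.1

theorem choi_unitaryMap [Nonempty H] (U : Matrix.unitaryGroup H ℂ) :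
    choi (unitaryMap U)
      = (Fintype.card H : ℝ) • vecMulVec (choiVec U) (star (choiVec U)) := by
  have hd : (√(Fintype.card H : ℝ) : ℂ) * √(Fintype.card H : ℝ) = (Fintype.card H : ℝ) := by
    rw [← Complex.ofReal_mul, Real.mul_self_sqrt (by positivity)]
  have hd0 : (√(Fintype.card H : ℝ) : ℂ) ≠ 0 := by
    rw [Complex.ofReal_ne_zero]
    exact (Real.sqrt_pos.2 (by exact_mod_cast Fintype.card_pos)).ne'
  ext x y
  have h : choi (unitaryMap U) x y
      = (U : Matrix H H ℂ) x.2 x.1 * star ((U : Matrix H H ℂ) y.2 y.1) := by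
    change ((U : Matrix H H ℂ) * Matrix.single x.1 y.1 (1 : ℂ) * (U : Matrix H H ℂ)ᴴ :
      Matrix H H ℂ) x.2 y.2 = _
    simp [Matrix.mul_apply, Matrix.single_apply, ite_and]
  rw [h, ← Complex.coe_smul, ← hd, Matrix.smul_apply, vecMulVec_apply, Pi.star_apply]
  simp only [choiVec, star_mul', smul_eq_mul, Complex.star_def, map_inv₀, Complex.conj_ofReal]
  field_simp

/-- Read off from the trace of the rank-one Choi matrix, which is the dimension by trace
preservation. -/
theorem choiVec_norm [Nonempty H] (U : Matrix.unitaryGroup H ℂ) :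
    star (choiVec U) ⬝ᵥ choiVec U = 1 := by
  have h := trace_choi (trace_unitaryMap U)
  rw [choi_unitaryMap, trace_smul, trace_vecMulVec, ← Complex.coe_smul, smul_eq_mul,
    dotProduct_comm] at h
  have hd : ((Fintype.card H : ℝ) : ℂ) ≠ 0 := by simp [Fintype.card_ne_zero]
  refine mul_left_cancel₀ hd ?_
  rw [h]
  simp

theorem choi_unitaryMap_posSemidef [Nonempty H] (U : Matrix.unitaryGroup H ℂ) :
    (choi (unitaryMap U)).PosSemidef := by
  rw [choi_unitaryMap]
  exact (posSemidef_vecMulVec_self_star _).smul (by positivity)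

/-- The entanglement fidelity of `Φ` with the unitary channel of `U`. -/
def entFidelity (U : Matrix.unitaryGroup H ℂ) (Φ : SuperOp H H) : ℝ :=
  (star (choiVec U) ⬝ᵥ ((Fintype.card H : ℝ)⁻¹ • choi Φ) *ᵥ choiVec U).re

theorem entFidelity_sum_smul {ι : Type*} [Fintype ι] (U : Matrix.unitaryGroup H ℂ)
    (N : ι → SuperOp H H) (p : ι → ℝ) :
    entFidelity U (∑ i, (p i : ℂ) • N i) = ∑ i, p i * entFidelity U (N i) := by
  simp only [entFidelity, choi_sum_smul, Finset.smul_sum, sum_mulVec, dotProduct_sum,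
    Complex.re_sum, smul_mulVec, dotProduct_smul, Complex.smul_re, smul_eq_mul]
  exact Finset.sum_congr rfl fun i _ => by ring

/-- The diamond distance to a unitary channel controls the infidelity of the Choi states. -/
theorem two_mul_one_sub_entFidelity_le [Nonempty H] (U : Matrix.unitaryGroup H ℂ)
    {Φ : SuperOp H H} (hΦ : (choi Φ).PosSemidef) (htr : ∀ X, (Φ X).trace = X.trace) :
    2 * (1 - entFidelity U Φ) ≤ diamondDist Φ (unitaryMap U) := by
  have hU := choi_unitaryMap_posSemidef U
  have hd : (Fintype.card H : ℝ) ≠ 0 := by simp [Fintype.card_ne_zero]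
  set e := Fintype.equivFin H
  set f := e.symm.prodCongr (Equiv.refl H)
  refine le_trans ?_ (traceNorm_le_diamondDist hΦ hU (maxEntangledState e))
  set J : Matrix (H × H) (H × H) ℂ := (Fintype.card H : ℝ)⁻¹ • (choi Φ - choi (unitaryMap U))
    with hJ
  have hX : idTensor (Fin (Fintype.card H)) Φ (maxEntangledState e).mat
      - idTensor (Fin (Fintype.card H)) (unitaryMap U) (maxEntangledState e).mat
      = J.submatrix f f := by
    rw [hJ]
    simp only [maxEntangledState, ← Complex.coe_smul, map_smul, idTensor_maxEntangled]
    rw [smul_sub]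
    rfl
  have hJh : J.IsHermitian :=
    (hΦ.isHermitian.sub hU.isHermitian).smul (k := (Fintype.card H : ℝ)⁻¹) (by simp [IsSelfAdjoint])
  have hJt : (J.submatrix f f).trace = 0 := by
    have h : (J.submatrix f f).trace = J.trace := by
      simp only [Matrix.trace, Matrix.diag, submatrix_apply]
      exact f.sum_comp fun x => J x x
    rw [h, hJ, trace_smul, trace_sub, trace_choi htr, trace_choi (trace_unitaryMap U), sub_self,
      smul_zero]
  have hψ : star (choiVec U ∘ f) ⬝ᵥ (choiVec U ∘ f) = 1 := by
    rw [← choiVec_norm U]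
    exact comp_equiv_dotProduct_comp_equiv (star (choiVec U)) (choiVec U) f
  have hval : star (choiVec U ∘ f) ⬝ᵥ J.submatrix f f *ᵥ (choiVec U ∘ f)
      = star (choiVec U) ⬝ᵥ J *ᵥ choiVec U := by
    rw [submatrix_mulVec_equiv]
    rw [Function.comp_assoc, Equiv.self_comp_symm, Function.comp_id]
    exact comp_equiv_dotProduct_comp_equiv (star (choiVec U)) (J *ᵥ choiVec U) f
  have h := neg_two_mul_re_le_traceNorm (hJh.submatrix f) hJt hψ
  -- The unitary's normalized Choi state is the projection onto `choiVec U` and contributes exactly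
  -- `1`.
  have hJψ : (star (choiVec U) ⬝ᵥ J *ᵥ choiVec U).re = entFidelity U Φ - 1 := by
    rw [hJ, smul_sub, sub_mulVec, dotProduct_sub, Complex.sub_re, choi_unitaryMap, smul_smul,
      inv_mul_cancel₀ hd, one_smul, vecMulVec_mulVec, choiVec_norm]
    simp [choiVec_norm, entFidelity]
  rw [hval, hJψ] at h
  rw [hX]
  linarith

/-- The infidelity of the Choi states controls the diamond distance to a unitary channel. -/
theorem diamondDist_unitaryMap_le [Nonempty H] (U : Matrix.unitaryGroup H ℂ)
    {Φ : SuperOp H H} (hΦ : (choi Φ).PosSemidef) (htr : ∀ X, (Φ X).trace = X.trace) :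
    0 ≤ 1 - entFidelity U Φ ∧
    diamondDist Φ (unitaryMap U) ≤ Fintype.card H * (2 * √(1 - entFidelity U Φ)) := by
  have hd : (Fintype.card H : ℝ) ≠ 0 := by simp [Fintype.card_ne_zero]
  have h1 : ((Fintype.card H : ℝ)⁻¹ • choi Φ).trace = 1 := by
    rw [trace_smul, trace_choi htr, ← Complex.coe_smul, smul_eq_mul]
    push_cast
    exact inv_mul_cancel₀ (by simp [Fintype.card_ne_zero])
  obtain ⟨P, Q, hP, hQ, hPQ, h0, hle⟩ := exists_posSemidef_sub_eq_state
    (hΦ.smul (a := (Fintype.card H : ℝ)⁻¹) (by positivity)) h1 (choiVec_norm U)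
  refine ⟨h0, ?_⟩
  have hdec : choi Φ - choi (unitaryMap U)
      = (Fintype.card H : ℝ) • P - (Fintype.card H : ℝ) • Q := by
    rw [← smul_sub, ← hPQ, smul_sub, smul_smul, mul_inv_cancel₀ hd, one_smul, choi_unitaryMap]
  have h := diamondDist_le_of_choi_sub_eq (hP.smul (a := (Fintype.card H : ℝ)) (by positivity))
    (hQ.smul (a := (Fintype.card H : ℝ)) (by positivity)) hdec
  rw [trace_smul, trace_smul, Complex.smul_re, Complex.smul_re, ← smul_add, smul_eq_mul] at h
  exact h.trans (mul_le_mul_of_nonneg_left hle (by positivity))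

/-- A mixture of channels close to a unitary channel is close to it on average. -/
theorem sum_mul_diamondDist_le {ι : Type*} [Fintype ι] (N : ι → QChannel H H) (p : ι → ℝ)
    (U : Matrix.unitaryGroup H ℂ) {ε : ℝ} (hp : ∀ i, 0 ≤ p i) (hp1 : ∑ i, p i = 1)
    (h : diamondDist (∑ i, (p i : ℂ) • (N i).map) (unitaryMap U) ≤ ε) :
    ∑ i, p i * diamondDist (N i).map (unitaryMap U) ≤ (Fintype.card H : ℝ) * √(2 * ε) := by
  -- In dimension zero there is no maximally entangled state, but all trace norms vanish.
  rcases isEmpty_or_nonempty H with hH | hH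
  · have h0 : ∀ i, diamondDist (N i).map (unitaryMap U) ≤ 0 := fun i => by
      refine Real.sSup_nonpos ?_
      rintro x ⟨k, ρ, rfl⟩
      simp [traceNorm]
    refine (Finset.sum_nonpos fun i _ => mul_nonpos_of_nonneg_of_nonpos (hp i) (h0 i)).trans ?_
    positivity
  have hc := fun i => choi_posSemidef (N i)
  have ht := fun i => (N i).trace_preserving
  have hlow : 2 * (1 - entFidelity U (∑ i, (p i : ℂ) • (N i).map)) ≤ ε := by
    refine (two_mul_one_sub_entFidelity_le U ?_ ?_).trans h
    · rw [choi_sum_smul]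
      exact posSemidef_sum _ fun i _ => (hc i).smul (hp i)
    · intro X
      rw [LinearMap.sum_apply, trace_sum]
      simp only [LinearMap.smul_apply, trace_smul, ht]
      rw [← Finset.sum_smul, ← Complex.ofReal_sum, hp1, Complex.ofReal_one, one_smul]
  have hb := fun i => diamondDist_unitaryMap_le U (hc i) (ht i)
  have hJ := Real.strictConcaveOn_sqrt.concaveOn.le_map_sum (t := Finset.univ) (w := p)
      (p := fun i => 1 - entFidelity U (N i).map) (fun i _ => hp i) hp1 (fun i _ => (hb i).1)
  simp only [smul_eq_mul, mul_sub, mul_one, Finset.sum_sub_distrib, hp1,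
    ← entFidelity_sum_smul] at hJ
  calc ∑ i, p i * diamondDist (N i).map (unitaryMap U)
      ≤ ∑ i, p i * (Fintype.card H * (2 * √(1 - entFidelity U (N i).map))) :=
        Finset.sum_le_sum fun i _ => mul_le_mul_of_nonneg_left (hb i).2 (hp i)
    _ = Fintype.card H * (2 * ∑ i, p i * √(1 - entFidelity U (N i).map)) := by
        simp only [Finset.mul_sum]
        exact Finset.sum_congr rfl fun i _ => by ring
    _ ≤ Fintype.card H * (2 * √(ε / 2)) := by
        gcongr
        refine hJ.trans (Real.sqrt_le_sqrt ?_)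
        linarith
    _ = Fintype.card H * √(2 * ε) := by
        congr 1
        rw [show 2 * ε = 2 ^ 2 * (ε / 2) by ring, Real.sqrt_mul (by positivity),
          Real.sqrt_sq (by norm_num)]

end Unitary

/-! ### Protocols as channels, affine in the resource -/

section Composition

variable {A B C D : Type*} [Fintype A] [Fintype B] [Fintype C] [Fintype D]

theorem QChannel.idTensor_posSemidef (N : QChannel A B) {R : Type*} [Fintype R]
    {X : Matrix (R × A) (R × A) ℂ} (hX : X.PosSemidef) : (idTensor R N.map X).PosSemidef := by
  set e := Fintype.equivFin R
  have h := (N.completely_positive _ _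
    (hX.submatrix (e.symm.prodCongr (Equiv.refl A)))).submatrix (e.prodCongr (Equiv.refl B))
  convert h using 1
  ext i j
  simp [idTensor, Function.comp_def]

theorem trace_idTensor {R : Type*} [Fintype R] {Φ : SuperOp A B}
    (hΦ : ∀ X, (Φ X).trace = X.trace) (X : Matrix (R × A) (R × A) ℂ) :
    (idTensor R Φ X).trace = X.trace := by
  simp only [Matrix.trace, Matrix.diag, Fintype.sum_prod_type]
  exact Finset.sum_congr rfl fun r _ => hΦ (X.submatrix (fun a => (r, a)) (fun a => (r, a)))

theorem trace_tensorId {R : Type*} [Fintype R] {Φ : SuperOp A B}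
    (hΦ : ∀ X, (Φ X).trace = X.trace) (X : Matrix (A × R) (A × R) ℂ) :
    (tensorId R Φ X).trace = X.trace := by
  simp only [Matrix.trace, Matrix.diag, Fintype.sum_prod_type_right]
  exact Finset.sum_congr rfl fun r _ => hΦ (X.submatrix (fun a => (a, r)) (fun a => (a, r)))

/-- The composition of two channels. -/
def QChannel.comp (M : QChannel B C) (N : QChannel A B) : QChannel A C where
  map := M.map ∘ₗ N.map
  completely_positive _ _ hX := M.idTensor_posSemidef (N.idTensor_posSemidef hX)
  trace_preserving X := (M.trace_preserving _).trans (N.trace_preserving X)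

/-- The channel `I_R ⊗ N`. -/
def QChannel.idTensor (R : Type*) [Fintype R] (N : QChannel A B) : QChannel (R × A) (R × B) where
  map := NLQC.idTensor R N.map
  completely_positive k X hX := by
    -- Reassociation absorbs `R` into the reference system.
    have h := (N.idTensor_posSemidef (R := Fin k × R)
      (hX.submatrix fun i => (i.1.1, (i.1.2, i.2)))).submatrix
      fun i : Fin k × (R × B) => ((i.1, i.2.1), i.2.2)
    exact h
  trace_preserving := trace_idTensor N.trace_preserving

/-- The channel `N ⊗ I_R`. -/
def QChannel.tensorId (R : Type*) [Fintype R] (N : QChannel A B) : QChannel (A × R) (B × R) where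
  map := NLQC.tensorId R N.map
  completely_positive k X hX := by
    have h := (N.idTensor_posSemidef (R := Fin k × R)
      (hX.submatrix fun i => (i.1.1, (i.2, i.1.2)))).submatrix
      fun i : Fin k × (B × R) => ((i.1, i.2.2), i.2.1)
    exact h
  trace_preserving := trace_tensorId N.trace_preserving

/-- The channel `N ⊗ M`. -/
def QChannel.tensor (N : QChannel A B) (M : QChannel C D) : QChannel (A × C) (B × D) :=
  (N.tensorId D).comp (M.idTensor A)

/-- Attaching a resource state is a channel. -/
def attachChannel {L R : Type*} [Fintype L] [Fintype R] (Ψ : QState (L × R)) :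
    QChannel (A × B) ((A × L) × (R × B)) where
  map := attach Ψ.mat
  completely_positive k X hX := by
    have h := (hX.kronecker Ψ.posSemidef).submatrix
      fun i : Fin k × ((A × L) × (R × B)) =>
        ((i.1, (i.2.1.1, i.2.2.2)), (i.2.1.2, i.2.2.1))
    exact h
  trace_preserving X := by
    have h : (attach Ψ.mat X).trace = X.trace * Ψ.mat.trace := by
      rw [← Matrix.trace_kronecker]
      exact Fintype.sum_equiv
        ⟨fun i : (A × L) × (R × B) => ((i.1.1, i.2.2), (i.1.2, i.2.1)),
          fun i => ((i.1.1, i.2.1), (i.2.2, i.1.2)), fun _ => rfl, fun _ => rfl⟩ _ _ fun _ => rfl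
    rw [h, Ψ.trace_eq_one, mul_one]

/-- The exchange of messages is a channel. -/
def exchangeChannel : QChannel ((A × D) × (C × B)) ((A × C) × (B × D)) where
  map := exchange
  completely_positive k _ hX :=
    hX.submatrix fun i : Fin k × ((A × C) × (B × D)) =>
      (i.1, ((i.2.1.1, i.2.2.2), (i.2.1.2, i.2.2.1)))
  trace_preserving _ :=
    Fintype.sum_equiv
      ⟨fun i : (A × C) × (B × D) => ((i.1.1, i.2.2), (i.1.2, i.2.1)),
        fun i => ((i.1.1, i.2.1), (i.2.2, i.1.2)), fun _ => rfl, fun _ => rfl⟩ _ _ fun _ => rfl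

/-- The map implemented by a protocol is a channel. -/
def Protocol.qChannel {l r : ℕ} (P : Protocol A B C D l r) (Ψ : QState (Fin l × Fin r)) :
    QChannel (A × B) (C × D) :=
  (P.WL.tensor P.WR).comp (exchangeChannel.comp ((P.VL.tensor P.VR).comp (attachChannel Ψ)))

theorem Protocol.qChannel_map {l r : ℕ} (P : Protocol A B C D l r)
    (Ψ : QState (Fin l × Fin r)) : (P.qChannel Ψ).map = P.channel Ψ :=
  rfl

/-- The implemented channel is affine in the resource state. -/
theorem Protocol.channel_eq_sum {l r : ℕ} (P : Protocol A B C D l r)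
    (Ψ : QState (Fin l × Fin r)) {ι : Type*} [Fintype ι] (p : ι → ℝ)
    (ψ : ι → QState (Fin l × Fin r)) (h : Ψ.mat = ∑ i, (p i : ℂ) • (ψ i).mat) :
    P.channel Ψ = ∑ i, (p i : ℂ) • P.channel (ψ i) := by
  have ha : ∀ X : Matrix (A × B) (A × B) ℂ,
      attach Ψ.mat X = ∑ i, (p i : ℂ) • attach (ψ i).mat X := by
    intro X
    ext x y
    simp only [attach, LinearMap.coe_mk, AddHom.coe_mk, submatrix_apply, kroneckerMap_apply, h,
      Matrix.sum_apply, Matrix.smul_apply, smul_eq_mul, Finset.mul_sum]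
    exact Finset.sum_congr rfl fun i _ => by ring
  refine LinearMap.ext fun X => ?_
  simp only [Protocol.channel, LinearMap.comp_apply, LinearMap.sum_apply, LinearMap.smul_apply,
    ha, map_sum, map_smul]

end Composition

/-! ### Pure-state ensembles and entanglement of formation -/

/-- Every state is a mixture of pure states. -/
theorem exists_pure_ensemble {A : Type*} [Fintype A] (ρ : QState A) :
    ∃ (n : ℕ) (p : Fin n → ℝ) (ψ : Fin n → PureState A),
      (∀ i, 0 ≤ p i) ∧ ∑ i, p i = 1 ∧ ρ.mat = ∑ i, (p i : ℂ) • (ψ i).toState.mat := by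
  classical
  have hH := ρ.posSemidef.isHermitian
  have hn : ∀ i, ∑ a, ‖(hH.eigenvectorUnitary : Matrix A A ℂ) a i‖ ^ 2 = 1 := by
    intro i
    have h := congrArg Complex.re (star_dotProduct_eigenvectorUnitary hH i)
    rw [Complex.one_re, dotProduct, Complex.re_sum] at h
    rw [← h]
    refine Finset.sum_congr rfl fun a _ => ?_
    rw [Pi.star_apply, Complex.star_def, ← Complex.normSq_eq_conj_mul_self, Complex.ofReal_re,
      Complex.normSq_eq_norm_sq]
  set e := (Fintype.equivFin A).symm
  refine ⟨Fintype.card A, fun i => hH.eigenvalues (e i), fun i => ⟨_, hn (e i)⟩,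
    fun i => ρ.posSemidef.eigenvalues_nonneg _, ?_, ?_⟩
  · rw [e.sum_comp fun i => hH.eigenvalues i, sum_eigenvalues_eq_trace_re, ρ.trace_eq_one,
      Complex.one_re]
  · conv_lhs => rw [eq_sum_eigenvalues_smul_vecMulVec hH]
    exact (e.sum_comp fun i => (hH.eigenvalues i : ℂ) •
      vecMulVec (fun a => (hH.eigenvectorUnitary : Matrix A A ℂ) a i)
        (star fun a => (hH.eigenvectorUnitary : Matrix A A ℂ) a i)).symm

/-- Entropy lower bounds for pure resources lift to lower bounds on the entanglement of
formation. -/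
theorem le_entanglementOfFormation {A B : Type*} [Fintype A] [DecidableEq A] [Fintype B]
    [DecidableEq B] (U : Matrix.unitaryGroup (A × B) ℂ) (lam : ℝ) {F : ℝ → ℝ}
    (hF : ConcaveOn ℝ (Set.Ici 0) F) (hmono : MonotoneOn F (Set.Ici 0))
    (hpure : ∀ (l r : ℕ) (P : Protocol A B A B l r) (ψ : PureState (Fin l × Fin r)) (ε : ℝ),
      P.Implements ψ.toState U ε → lam - F ε ≤ entropy ψ.toState.right)
    {l r : ℕ} (P : Protocol A B A B l r) (Ψ : QState (Fin l × Fin r)) {ε : ℝ}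
    (hP : P.Implements Ψ U ε) :
    lam - F (((Fintype.card A * Fintype.card B : ℕ) : ℝ) * √(2 * ε))
      ≤ entanglementOfFormation Ψ := by
  -- This ensemble only shows that the infimum is over a nonempty set, as `le_csInf` requires; the
  -- bound is then proved for an arbitrary one.
  obtain ⟨n, p, ψ, hp, hp1, hΨ⟩ := exists_pure_ensemble Ψ
  refine le_csInf ⟨_, n, p, ψ, hp, hp1, hΨ, rfl⟩ ?_
  clear hΨ hp1 hp ψ p n
  rintro x ⟨n, p, ψ, hp, hp1, hΨ, rfl⟩
  set δ : Fin n → ℝ := fun i => diamondDist (P.channel (ψ i).toState) (unitaryMap U) with hδ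
  have hδ0 : ∀ i, 0 ≤ δ i := fun i => diamondDist_nonneg _ _
  have havg : ∑ i, p i * δ i ≤ ((Fintype.card A * Fintype.card B : ℕ) : ℝ) * √(2 * ε) := by
    rw [← Fintype.card_prod]
    refine sum_mul_diamondDist_le (fun i => P.qChannel (ψ i).toState) p U hp hp1 ?_
    simp only [Protocol.qChannel_map]
    rw [← P.channel_eq_sum Ψ p (fun i => (ψ i).toState) hΨ]
    exact hP
  have hJ := hF.le_map_sum (t := Finset.univ) (w := p) (p := δ) (fun i _ => hp i) hp1
    (fun i _ => hδ0 i)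
  simp only [smul_eq_mul] at hJ
  have hM := hmono (Finset.sum_nonneg fun i _ => mul_nonneg (hp i) (hδ0 i))
    (Set.mem_Ici.2 (by positivity)) havg
  calc lam - F (((Fintype.card A * Fintype.card B : ℕ) : ℝ) * √(2 * ε))
      ≤ lam - ∑ i, p i * F (δ i) := by linarith
    _ = ∑ i, p i * (lam - F (δ i)) := by
        simp only [mul_sub, Finset.sum_sub_distrib, ← Finset.sum_mul, hp1, one_mul]
    _ ≤ ∑ i, p i * entropy (ψ i).toState.right :=
        -- The pure-state hypothesis is used at the exact error `δ i`, so correctness is `le_rfl`.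
        Finset.sum_le_sum fun i _ =>
          mul_le_mul_of_nonneg_left (hpure l r P (ψ i) (δ i) le_rfl) (hp i)

end NLQC

end

theorem mainTheorem7 {H ι A B : Type*} [Fintype H] [DecidableEq H] [Fintype ι]
    [Fintype A] [DecidableEq A] [Fintype B] [DecidableEq B] :
    -- a convex mixture of channels that is close to a unitary channel is close to it on average
    (∀ (N : ι → NLQC.QChannel H H) (p : ι → ℝ) (U : Matrix.unitaryGroup H ℂ) (ε : ℝ),
      (∀ i, 0 ≤ p i) → ∑ i, p i = 1 →
      NLQC.diamondDist (∑ i, (p i : ℂ) • (N i).map) (NLQC.unitaryMap U) ≤ ε →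
      ∑ i, p i * NLQC.diamondDist (N i).map (NLQC.unitaryMap U)
        ≤ (Fintype.card H : ℝ) * √(2 * ε)) ∧
    -- entropy lower bounds for pure resources give entanglement lower bounds for all resources
    (∀ (U : Matrix.unitaryGroup (A × B) ℂ) (lam : ℝ) (F : ℝ → ℝ),
      ConcaveOn ℝ (Set.Ici 0) F → MonotoneOn F (Set.Ici 0) →
      (∀ (l r : ℕ) (P : NLQC.Protocol A B A B l r) (ψ : NLQC.PureState (Fin l × Fin r)) (ε : ℝ),
        P.Implements ψ.toState U ε → lam - F ε ≤ NLQC.entropy ψ.toState.right) →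
      ∀ (l r : ℕ) (P : NLQC.Protocol A B A B l r) (Ψ : NLQC.QState (Fin l × Fin r)) (ε : ℝ),
        P.Implements Ψ U ε →
        lam - F (((Fintype.card A * Fintype.card B : ℕ) : ℝ) * √(2 * ε))
          ≤ NLQC.entanglementOfFormation Ψ) := by
  refine ⟨fun N p U _ hp hp1 h => NLQC.sum_mul_diamondDist_le N p U hp hp1 h, ?_⟩
  intro U lam F hF hmono hpure l r P Ψ _ hP
  exact NLQC.le_entanglementOfFormation U lam hF hmono hpure P Ψ hP
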